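/- Let $H\in\mathbb{R}[x,y]$ be a polynomial with real coefficients, let $N\ge 1$, let $\alpha^{(1)},\dots,\alpha^{(N)}\in\mathbb{N}^2\setminus\{(0,0)\}$ (where $\mathbb{N}$ contains $0$), and put $$D=\{(x,y)\in[0,1]^2:\ |\partial^{\alpha^{(i)}}H(x,y)|\ge 1\ \text{ for } 1\le i\le N\},$$ where for $\alpha=(\alpha_1,\alpha_2)$ we write $\partial^{\alpha}=\partial_x^{\alpha_1}\partial_y^{\alpha_2}$ and $|\alpha|=\alpha_1+\alpha_2$. For $\mu>0$ and $f,g,h\in L^2(\mathbb{R})$ (complex-valued) let $$K_\mu(f,g,h)=\int_D \chi_{\{|H(x,y)|\le\mu\}}\,f(x)\,g(y)\,h(x+y)\,dx\,dy .$$ Then this integral converges absolutely, and there is a constant $C>0$, depending only on the total degree $\deg H$ (in particular not on $N$, the $\alpha^{(i)}$, $\mu$, $f,g,h$, or the coefficients of $H$), such that $$|K_\mu(f,g,h)|\le C\,\mu^{\frac{1}{2d}}\,\|f\|_2\|g\|_2\|h\|_2,\qquad d=\min\{|\alpha^{(i)}|:1\le i\le N\}.$$ -/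

import Mathlib

open MeasureTheory

namespace TrilinearSublevel

/-- The value `P(x, y)` of a real polynomial in two variables at `p = (x, y)`;
variable `0` is `x` and variable `1` is `y`. -/
noncomputable def evalAt (P : MvPolynomial (Fin 2) ℝ) (p : ℝ × ℝ) : ℝ :=
  MvPolynomial.eval ![p.1, p.2] P

/-- The mixed partial derivative `∂^a P = ∂_x^{a₁} ∂_y^{a₂} P`. -/
noncomputable def mixedDeriv (a : ℕ × ℕ) (P : MvPolynomial (Fin 2) ℝ) :
    MvPolynomial (Fin 2) ℝ :=
  (MvPolynomial.pderiv (0 : Fin 2))^[a.1] ((MvPolynomial.pderiv (1 : Fin 2))^[a.2] P)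

/-- The order `|a| = a₁ + a₂` of a multi-index. -/
def order (a : ℕ × ℕ) : ℕ := a.1 + a.2

/-- The domain `D = {(x, y) ∈ [0,1]² : |∂^{α i} H(x, y)| ≥ 1 for all i}`. -/
def domain {N : ℕ} (H : MvPolynomial (Fin 2) ℝ) (α : Fin N → ℕ × ℕ) : Set (ℝ × ℝ) :=
  {p | p ∈ Set.Icc (0 : ℝ) 1 ×ˢ Set.Icc (0 : ℝ) 1 ∧
    ∀ i, 1 ≤ |evalAt (mixedDeriv (α i) H) p|}

/-- The integrand `χ_{|H(x, y)| ≤ μ} f(x) g(y) h(x + y)`. -/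
noncomputable def integrand (H : MvPolynomial (Fin 2) ℝ) (μ : ℝ) (f g h : ℝ → ℂ)
    (p : ℝ × ℝ) : ℂ :=
  Set.indicator {q : ℝ × ℝ | |evalAt H q| ≤ μ} (fun _ => (1 : ℂ)) p *
    f p.1 * g p.2 * h (p.1 + p.2)

/-- The trilinear sublevel set form
`K_μ(f, g, h) = ∫_D χ_{|H| ≤ μ} f(x) g(y) h(x + y) dx dy`. -/
noncomputable def sublevelForm (H : MvPolynomial (Fin 2) ℝ) (D : Set (ℝ × ℝ)) (μ : ℝ)
    (f g h : ℝ → ℂ) : ℂ :=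
  ∫ p in D, integrand H μ f g h p

/-- The `L²(ℝ)` norm. -/
noncomputable def l2Norm (f : ℝ → ℂ) : ℝ := (eLpNorm f 2 volume).toReal

end TrilinearSublevel

/-!
The weight `χ_{|H| ≤ μ}` is nonnegative, so it suffices to bound the form on nonnegative functions
over sets `E ⊆ ℝ²`, and only a multi-index of least order `d` has to be kept from those defining
the domain.

If all slices of `E` in the direction of one coordinate axis have measure at most `M`, the
Cauchy–Schwarz inequality bounds the form over `E` by `M^{1/2} ‖f‖₂ ‖g‖₂ ‖h‖₂`
(`trilinearBound_of_volume_slice_le`). For `E = {|∂_i G| ≥ l, |G| ≤ t}` the slices are sublevel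
sets of polynomials `p` in one variable with `|p'| ≥ l`; cutting the line at the critical points
of `p` leaves at most `deg p` intervals on which `p` is injective, so each slice has measure
`O(t / l)` (`volume_sublevel_le`). This is the case of first derivatives (`trilinearBound_pderiv`).

For higher order, `trilinearBound_mixedDeriv` argues by induction: write `∂^a = ∂_i ∂^b`, and split
`{|∂^a H| ≥ l, |H| ≤ m}` according to whether `|∂^b H|` is below or above
`t = l (m / l)^{1/d}`. The first order case, applied to `∂^b H`, bounds the first part by
`(t / l)^{1/2}`; the induction hypothesis bounds the second by `(m / t)^{1/(2(d-1))}`. Both are equal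
to `(m / l)^{1/(2d)}`. The constant grows linearly in `d`, and a nonzero derivative of `H` has order
at most `deg H`, so in the end the constant depends on `deg H` only.
-/

open scoped ENNReal

namespace TrilinearSublevel

/-! ### Polynomial derivatives and slices -/

lemma exists_mixedDeriv_eq_pderiv {a : ℕ × ℕ} {k : ℕ} (ha : order a = k + 1) :
    ∃ (i : Fin 2) (b : ℕ × ℕ), order b = k ∧
      ∀ H, mixedDeriv a H = MvPolynomial.pderiv i (mixedDeriv b H) := by
  obtain ⟨a₁, a₂⟩ := a
  rcases a₁ with _ | a₁
  · rcases a₂ with _ | a₂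
    · simp [order] at ha
    · exact ⟨1, (0, a₂), by simp only [order] at *; omega,
        fun H => by simp [mixedDeriv, Function.iterate_succ_apply']⟩
  · exact ⟨0, (a₁, a₂), by simp only [order] at *; omega,
      fun H => by simp [mixedDeriv, Function.iterate_succ_apply']⟩

lemma mixedDeriv_of_order_eq_zero {a : ℕ × ℕ} (ha : order a = 0)
    (H : MvPolynomial (Fin 2) ℝ) : mixedDeriv a H = H := by
  obtain ⟨a₁, a₂⟩ := a
  simp only [order, Nat.add_eq_zero_iff] at ha
  simp [mixedDeriv, ha.1, ha.2]

lemma totalDegree_pderiv_add_one_le {σ R : Type*} [CommSemiring R] (i : σ)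
    (P : MvPolynomial σ R) (h : MvPolynomial.pderiv i P ≠ 0) :
    (MvPolynomial.pderiv i P).totalDegree + 1 ≤ P.totalDegree := by
  classical
  obtain ⟨m, hm, hmax⟩ := Finset.exists_mem_eq_sup (MvPolynomial.pderiv i P).support
    (MvPolynomial.support_nonempty.2 h) (fun s => s.sum fun _ e => e)
  have hm' : m + Finsupp.single i 1 ∈ P.support := by
    rw [MvPolynomial.mem_support_iff] at hm ⊢
    intro h0
    rw [MvPolynomial.coeff_pderiv, h0, zero_mul] at hm
    exact hm rfl
  have hle := MvPolynomial.le_totalDegree hm'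
  rw [Finsupp.sum_add_index' (fun _ => rfl) (fun _ _ _ => rfl),
    Finsupp.sum_single_index rfl] at hle
  rw [MvPolynomial.totalDegree, hmax]
  exact hle

lemma order_add_totalDegree_mixedDeriv_le (H : MvPolynomial (Fin 2) ℝ) (a : ℕ × ℕ)
    (h : mixedDeriv a H ≠ 0) :
    order a + (mixedDeriv a H).totalDegree ≤ H.totalDegree := by
  induction hk : order a generalizing a with
  | zero => simp [mixedDeriv_of_order_eq_zero hk]
  | succ k ih =>
    obtain ⟨i, b, hb, hab⟩ := exists_mixedDeriv_eq_pderiv hk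
    rw [hab] at h ⊢
    have hb0 : mixedDeriv b H ≠ 0 := fun h0 => h (by rw [h0, map_zero])
    have := ih b hb0 hb
    have := totalDegree_pderiv_add_one_le i _ h
    omega

lemma totalDegree_mixedDeriv_le (H : MvPolynomial (Fin 2) ℝ) (a : ℕ × ℕ) :
    (mixedDeriv a H).totalDegree ≤ H.totalDegree := by
  by_cases h : mixedDeriv a H = 0
  · simp [h]
  · exact le_of_add_le_right (order_add_totalDegree_mixedDeriv_le H a h)

lemma continuous_evalAt (P : MvPolynomial (Fin 2) ℝ) : Continuous (evalAt P) := by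
  refine (MvPolynomial.continuous_eval P).comp (continuous_pi fun i => ?_)
  fin_cases i
  · exact continuous_fst
  · exact continuous_snd

/-- Freezing all variables but the `i`-th turns a polynomial into a polynomial in one variable,
whose degree is at most the total degree and whose derivative comes from the `i`-th partial
derivative. -/
lemma exists_polynomial_slice {σ : Type*} [DecidableEq σ] (P : MvPolynomial σ ℝ) (i : σ)
    (v : σ → ℝ) :
    ∃ p : Polynomial ℝ, p.natDegree ≤ P.totalDegree ∧
      (∀ x, p.eval x = MvPolynomial.eval (Function.update v i x) P) ∧
      ∀ x, p.derivative.eval x =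
        MvPolynomial.eval (Function.update v i x) (MvPolynomial.pderiv i P) := by
  set w : σ → Polynomial ℝ := Function.update (fun j => Polynomial.C (v j)) i Polynomial.X with hw
  have hw1 : ∀ j x, (w j).eval x = Function.update v i x j := by
    intro j x
    by_cases h : j = i
    · subst h; simp [hw]
    · simp [hw, h]
  have hw2 : ∀ j, (w j).derivative = if j = i then 1 else 0 := by
    intro j
    by_cases h : j = i
    · subst h; simp [hw]
    · simp [hw, h]
  have hw3 : ∀ j, (w j).natDegree ≤ 1 := by
    intro j
    by_cases h : j = i
    · subst h; simp [hw]
    · simp [hw, h]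
  have hev : ∀ (Q : MvPolynomial σ ℝ) (x : ℝ),
      (MvPolynomial.aeval w Q).eval x = MvPolynomial.eval (Function.update v i x) Q := by
    intro Q x
    induction Q using MvPolynomial.induction_on with
    | C a => simp
    | add p q hp hq => rw [map_add, Polynomial.eval_add, hp, hq, map_add]
    | mul_X p j hp =>
      rw [map_mul, MvPolynomial.aeval_X, Polynomial.eval_mul, hp, hw1, map_mul,
        MvPolynomial.eval_X]
  refine ⟨MvPolynomial.aeval w P, ?_, hev P, fun x => ?_⟩
  · exact (MvPolynomial.aeval_natDegree_le P le_rfl w hw3).trans (mul_one _).le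
  · rw [← hev]
    congr 1
    induction P using MvPolynomial.induction_on with
    | C a => simp
    | add p q hp hq => simp only [map_add, hp, hq]
    | mul_X p j hp =>
      rw [map_mul, MvPolynomial.aeval_X, Polynomial.derivative_mul, hp, hw2,
        MvPolynomial.pderiv_mul, MvPolynomial.pderiv_X, map_add, map_mul, map_mul,
        MvPolynomial.aeval_X]
      by_cases h : j = i
      · subst h; simp
      · simp [h]

/-! ### A one-dimensional sublevel set estimate -/

/-- Where `f` is injective its image of a set has measure at least `l` times the measure of that
set, if `|f'| ≥ l` there; an image inside `[-t, t]` has measure at most `2t`. -/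
lemma mul_volume_le_of_injOn {f f' : ℝ → ℝ} {s : Set ℝ} {l t : ℝ} (hs : MeasurableSet s)
    (hf : ∀ x ∈ s, HasDerivWithinAt f (f' x) s x) (hinj : Set.InjOn f s)
    (hl : ∀ x ∈ s, l ≤ |f' x|) (ht : ∀ x ∈ s, |f x| ≤ t) :
    ENNReal.ofReal l * volume s ≤ ENNReal.ofReal (2 * t) := by
  have h := lintegral_image_eq_lintegral_abs_deriv_mul hs hf hinj (fun _ => 1)
  simp only [mul_one, setLIntegral_one] at h
  calc ENNReal.ofReal l * volume s = ∫⁻ _ in s, ENNReal.ofReal l := by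
        rw [setLIntegral_const]
    _ ≤ ∫⁻ x in s, ENNReal.ofReal |f' x| :=
        setLIntegral_mono' hs fun x hx => ENNReal.ofReal_le_ofReal (hl x hx)
    _ = volume (f '' s) := h.symm
    _ ≤ volume (Set.Icc (-t) t) := by
        refine measure_mono ?_
        rintro _ ⟨x, hx, rfl⟩
        exact abs_le.1 (ht x hx)
    _ = ENNReal.ofReal (2 * t) := by rw [Real.volume_Icc]; congr 1; ring

lemma volume_sublevel_le {n : ℕ} {p : Polynomial ℝ} (hp : p.natDegree ≤ n) {l t : ℝ}
    (hl : 0 < l) :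
    volume {x : ℝ | l ≤ |p.derivative.eval x| ∧ |p.eval x| ≤ t} ≤
      ENNReal.ofReal (2 * (n + 1) * (t / l)) := by
  -- `c x` counts the critical points below `x`; two points of the set with the same count have
  -- no critical point between them, so by Rolle `p` is injective on each level set of `c`.
  set c : ℝ → ℕ := fun x => (p.derivative.roots.toFinset.filter (· < x)).card with hc
  have hcmono : Monotone c := fun x y hxy => Finset.card_le_card fun z hz => by
    simp only [Finset.mem_filter] at hz ⊢
    exact ⟨hz.1, hz.2.trans_le hxy⟩
  have hcle : ∀ x, c x ≤ n := fun x =>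
    (Finset.card_filter_le _ _).trans <| (Multiset.toFinset_card_le _).trans <|
      (Polynomial.card_roots' _).trans <| (Polynomial.natDegree_derivative_le p).trans (by omega)
  set s : Set ℝ := {x | l ≤ |p.derivative.eval x| ∧ |p.eval x| ≤ t} with hs
  have hsm : MeasurableSet s :=
    ((isClosed_le continuous_const p.derivative.continuous.abs).inter
      (isClosed_le p.continuous.abs continuous_const)).measurableSet
  have hpiece : ∀ k, volume (s ∩ c ⁻¹' {k}) ≤ ENNReal.ofReal (2 * (t / l)) := by
    intro k
    have hinj : Set.InjOn (fun x => p.eval x) (s ∩ c ⁻¹' {k}) := by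
      have key : ∀ x ∈ s ∩ c ⁻¹' {k}, ∀ y ∈ s ∩ c ⁻¹' {k}, x < y →
          p.eval x ≠ p.eval y := by
        intro x hx y hy hxy heq
        obtain ⟨z, hz, hz0⟩ := exists_hasDerivAt_eq_zero hxy p.continuous.continuousOn heq
          (fun w _ => p.hasDerivAt w)
        have hne : p.derivative ≠ 0 := by
          rintro h0
          have := hx.1.1
          rw [h0] at this
          simp at this
          linarith
        have hlt : c x < c y := by
          refine Finset.card_lt_card ⟨fun w hw => ?_, fun hsub => ?_⟩
          · simp only [Finset.mem_filter] at hw ⊢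
            exact ⟨hw.1, hw.2.trans hxy⟩
          · have hmem : z ∈ p.derivative.roots.toFinset.filter (· < y) := by
              simp only [Finset.mem_filter, Multiset.mem_toFinset]
              exact ⟨(Polynomial.mem_roots hne).2 hz0, hz.2⟩
            exact lt_asymm (Finset.mem_filter.1 (hsub hmem)).2 hz.1
        have h1 : c x = k := hx.2
        have h2 : c y = k := hy.2
        omega
      intro x hx y hy hxy
      rcases lt_trichotomy x y with h | h | h
      · exact absurd hxy (key x hx y hy h)
      · exact h
      · exact absurd hxy.symm (key y hy x hx h)
    have h := mul_volume_le_of_injOn (hsm.inter (hcmono.measurable (measurableSet_singleton k)))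
      (fun x _ => (p.hasDerivAt x).hasDerivWithinAt) hinj (fun x hx => hx.1.1)
      (fun x hx => hx.1.2)
    rw [mul_comm] at h
    refine ((ENNReal.le_div_iff_mul_le (Or.inl (by simpa using hl))
      (Or.inl (by simp))).2 h).trans ?_
    rw [← ENNReal.ofReal_div_of_pos hl, mul_div_assoc]
  calc volume s ≤ volume (⋃ k ∈ Finset.range (n + 1), s ∩ c ⁻¹' {k}) := by
        refine measure_mono fun x hx => ?_
        simp only [Set.mem_iUnion]
        exact ⟨c x, Finset.mem_range.2 (Nat.lt_succ_of_le (hcle x)), hx, rfl⟩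
    _ ≤ ∑ k ∈ Finset.range (n + 1), volume (s ∩ c ⁻¹' {k}) := measure_biUnion_finset_le _ _
    _ ≤ ∑ _k ∈ Finset.range (n + 1), ENNReal.ofReal (2 * (t / l)) :=
        Finset.sum_le_sum fun k _ => hpiece k
    _ = ENNReal.ofReal (2 * (n + 1) * (t / l)) := by
        rw [Finset.sum_const, Finset.card_range, ← ENNReal.ofReal_nsmul]
        congr 1
        simp only [nsmul_eq_mul]
        push_cast
        ring

/-! ### Trilinear bounds over a set -/

/-- The trilinear form `∫_E f(x) g(y) h(x + y) dx dy` of nonnegative functions is bounded by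
`A ‖f‖₂ ‖g‖₂ ‖h‖₂`. -/
def TrilinearBound (E : Set (ℝ × ℝ)) (A : ℝ≥0∞) : Prop :=
  ∀ f g h : ℝ → ℝ≥0∞, AEMeasurable f → AEMeasurable g → AEMeasurable h →
    ∫⁻ p in E, f p.1 * g p.2 * h (p.1 + p.2) ≤
      A * (∫⁻ x, f x ^ (2 : ℝ)) ^ (1 / 2 : ℝ) * (∫⁻ x, g x ^ (2 : ℝ)) ^ (1 / 2 : ℝ) *
        (∫⁻ x, h x ^ (2 : ℝ)) ^ (1 / 2 : ℝ)

lemma TrilinearBound.union_of_subset {E E₁ E₂ : Set (ℝ × ℝ)} {A₁ A₂ : ℝ≥0∞}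
    (h₁ : TrilinearBound E₁ A₁) (h₂ : TrilinearBound E₂ A₂) (hE : E ⊆ E₁ ∪ E₂) :
    TrilinearBound E (A₁ + A₂) := by
  intro f g h hf hg hh
  refine (lintegral_mono_set hE).trans <| (lintegral_union_le _ _ _).trans ?_
  rw [add_mul, add_mul, add_mul]
  exact add_le_add (h₁ f g h hf hg hh) (h₂ f g h hf hg hh)

lemma TrilinearBound.mono {E : Set (ℝ × ℝ)} {A B : ℝ≥0∞} (h : TrilinearBound E A)
    (hAB : A ≤ B) : TrilinearBound E B := fun f g k hf hg hk =>
  (h f g k hf hg hk).trans (by gcongr)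

lemma TrilinearBound.of_swap {E : Set (ℝ × ℝ)} {A : ℝ≥0∞}
    (h : TrilinearBound (Prod.swap ⁻¹' E) A) (hE : MeasurableSet E) : TrilinearBound E A := by
  intro f g k hf hg hk
  have hswap : ∫⁻ p in E, f p.1 * g p.2 * k (p.1 + p.2) =
      ∫⁻ p in Prod.swap ⁻¹' E, g p.1 * f p.2 * k (p.1 + p.2) := by
    rw [← lintegral_indicator hE, ← lintegral_indicator (measurable_swap hE),
      Measure.volume_eq_prod, ← lintegral_prod_swap]
    refine lintegral_congr fun p => ?_
    by_cases hp : p.swap ∈ E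
    · rw [Set.indicator_of_mem hp, Set.indicator_of_mem (Set.mem_preimage.2 hp)]
      simp only [Prod.fst_swap, Prod.snd_swap, add_comm p.2, mul_comm (f p.2)]
    · rw [Set.indicator_of_notMem hp, Set.indicator_of_notMem (by simpa using hp)]
  rw [hswap]
  refine (h g f k hg hf hk).trans_eq ?_
  ring

/-- If every horizontal slice of `E` has measure at most `M`, then the Cauchy–Schwarz inequality,
with `f(x) h(x + y)` as one factor and `χ_E(x, y) g(y)` as the other, gives a bound `M^{1/2}`. -/
lemma trilinearBound_of_volume_slice_le {E : Set (ℝ × ℝ)} (hE : MeasurableSet E) {M : ℝ≥0∞}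
    (hM : ∀ y, volume {x | (x, y) ∈ E} ≤ M) : TrilinearBound E (M ^ (1 / 2 : ℝ)) := by
  intro f g h hf hg hh
  have hf' : AEMeasurable (fun p : ℝ × ℝ => f p.1) (volume.prod volume) :=
    hf.comp_quasiMeasurePreserving Measure.quasiMeasurePreserving_fst
  have hg' : AEMeasurable (fun p : ℝ × ℝ => g p.2) (volume.prod volume) :=
    hg.comp_quasiMeasurePreserving Measure.quasiMeasurePreserving_snd
  have hh' : AEMeasurable (fun p : ℝ × ℝ => h (p.1 + p.2)) (volume.prod volume) :=
    hh.comp_quasiMeasurePreserving (quasiMeasurePreserving_add volume volume)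
  have hfirst : ∫⁻ p : ℝ × ℝ, (f p.1 * h (p.1 + p.2)) ^ (2 : ℝ) =
      (∫⁻ x, f x ^ (2 : ℝ)) * ∫⁻ x, h x ^ (2 : ℝ) := by
    have hfh : AEMeasurable (fun p : ℝ × ℝ => (f p.1 * h (p.1 + p.2)) ^ (2 : ℝ))
        (volume.prod volume) := (hf'.mul hh').pow_const _
    rw [Measure.volume_eq_prod, lintegral_prod _ hfh, ← lintegral_mul_const'' _ (hf.pow_const _)]
    refine lintegral_congr fun x => ?_
    simp only [ENNReal.mul_rpow_of_nonneg _ _ zero_le_two]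
    have hx : AEMeasurable (fun y => h (x + y) ^ (2 : ℝ)) :=
      (hh.comp_quasiMeasurePreserving
        (measurePreserving_add_left volume x).quasiMeasurePreserving).pow_const _
    rw [lintegral_const_mul'' _ hx, lintegral_add_left_eq_self (fun y => h y ^ (2 : ℝ)) x]
  have hsecond : ∫⁻ p : ℝ × ℝ, (E.indicator (fun q => g q.2) p) ^ (2 : ℝ) ≤
      M * ∫⁻ x, g x ^ (2 : ℝ) := by
    rw [Measure.volume_eq_prod, lintegral_prod_symm _ ((hg'.indicator hE).pow_const _),
      ← lintegral_const_mul'' _ (hg.pow_const _)]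
    refine lintegral_mono fun y => ?_
    have hslice : MeasurableSet {x | (x, y) ∈ E} := measurable_prodMk_right hE
    calc ∫⁻ x, (E.indicator (fun q => g q.2) (x, y)) ^ (2 : ℝ)
        = ∫⁻ x, {x | (x, y) ∈ E}.indicator (fun _ => g y ^ (2 : ℝ)) x := by
          refine lintegral_congr fun x => ?_
          by_cases hx : (x, y) ∈ E
          · rw [Set.indicator_of_mem hx, Set.indicator_of_mem (by exact hx)]
          · rw [Set.indicator_of_notMem hx, Set.indicator_of_notMem (by exact hx),
              ENNReal.zero_rpow_of_pos two_pos]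
      _ = g y ^ (2 : ℝ) * volume {x | (x, y) ∈ E} := lintegral_indicator_const hslice _
      _ ≤ M * g y ^ (2 : ℝ) := by rw [mul_comm]; gcongr; exact hM y
  calc ∫⁻ p in E, f p.1 * g p.2 * h (p.1 + p.2)
      = ∫⁻ p, ((fun p : ℝ × ℝ => f p.1 * h (p.1 + p.2)) * E.indicator fun q => g q.2) p := by
        rw [← lintegral_indicator hE]
        refine lintegral_congr fun p => ?_
        by_cases hp : p ∈ E
        · simp only [Set.indicator_of_mem hp, Pi.mul_apply]; ring
        · simp only [Set.indicator_of_notMem hp, Pi.mul_apply, mul_zero]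
    _ ≤ (∫⁻ p : ℝ × ℝ, (f p.1 * h (p.1 + p.2)) ^ (2 : ℝ)) ^ (1 / 2 : ℝ) *
        (∫⁻ p : ℝ × ℝ, (E.indicator (fun q => g q.2) p) ^ (2 : ℝ)) ^ (1 / 2 : ℝ) :=
        ENNReal.lintegral_mul_le_Lp_mul_Lq _ Real.HolderConjugate.two_two (hf'.mul hh')
          (hg'.indicator hE)
    _ ≤ ((∫⁻ x, f x ^ (2 : ℝ)) * ∫⁻ x, h x ^ (2 : ℝ)) ^ (1 / 2 : ℝ) *
        (M * ∫⁻ x, g x ^ (2 : ℝ)) ^ (1 / 2 : ℝ) := by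
        rw [hfirst]; gcongr
    _ = _ := by
        simp only [ENNReal.mul_rpow_of_nonneg _ _ (one_div_nonneg.2 (zero_le_two (α := ℝ)))]
        ring

/-! ### Induction on the order of the derivative -/

lemma trilinearBound_pderiv {n : ℕ} {G : MvPolynomial (Fin 2) ℝ} (hG : G.totalDegree ≤ n)
    (i : Fin 2) {l t : ℝ} (hl : 0 < l) (ht : 0 ≤ t) :
    TrilinearBound {p | l ≤ |evalAt (MvPolynomial.pderiv i G) p| ∧ |evalAt G p| ≤ t}
      (ENNReal.ofReal (√(2 * (n + 1)) * (t / l) ^ (1 / 2 : ℝ))) := by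
  set E : Set (ℝ × ℝ) :=
    {p | l ≤ |evalAt (MvPolynomial.pderiv i G) p| ∧ |evalAt G p| ≤ t} with hEdef
  have hE : MeasurableSet E :=
    ((isClosed_le continuous_const (continuous_evalAt _).abs).inter
      (isClosed_le (continuous_evalAt _).abs continuous_const)).measurableSet
  have hconst : ENNReal.ofReal (√(2 * (n + 1)) * (t / l) ^ (1 / 2 : ℝ)) =
      ENNReal.ofReal (2 * (n + 1) * (t / l)) ^ (1 / 2 : ℝ) := by
    rw [ENNReal.ofReal_rpow_of_nonneg (by positivity) (by norm_num),
      Real.mul_rpow (by positivity) (by positivity), Real.sqrt_eq_rpow]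
  rw [hconst]
  fin_cases i
  · refine trilinearBound_of_volume_slice_le hE fun y => ?_
    obtain ⟨p, hdeg, hp, hp'⟩ := exists_polynomial_slice G 0 ![0, y]
    have hv : ∀ x, Function.update ![0, y] 0 x = ![x, y] := fun x => by
      ext j; fin_cases j <;> rfl
    refine le_of_eq_of_le (congrArg _ (Set.ext fun x => ?_))
      (volume_sublevel_le (hdeg.trans hG) hl)
    simp [hEdef, evalAt, hp, hp', hv]
  · refine TrilinearBound.of_swap
      (trilinearBound_of_volume_slice_le (measurable_swap hE) fun x => ?_) hE
    obtain ⟨p, hdeg, hp, hp'⟩ := exists_polynomial_slice G 1 ![x, 0]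
    have hv : ∀ y, Function.update ![x, 0] 1 y = ![x, y] := fun y => by
      ext j; fin_cases j <;> rfl
    refine le_of_eq_of_le (congrArg _ (Set.ext fun y => ?_))
      (volume_sublevel_le (hdeg.trans hG) hl)
    simp [hEdef, evalAt, hp, hp', hv]

/-- The sublevel estimate for a single derivative of order `k + 1`. With `∂^a = ∂_i ∂^b`, the set
is split according to the size of `∂^b H`: where it is small, `∂^b H` satisfies a first order
sublevel estimate, and where it is large, the induction hypothesis applies to it. -/
lemma trilinearBound_mixedDeriv {n : ℕ} {H : MvPolynomial (Fin 2) ℝ} (hH : H.totalDegree ≤ n)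
    {m : ℝ} (hm : 0 < m) (k : ℕ) {a : ℕ × ℕ} (ha : order a = k + 1) {l : ℝ} (hl : 0 < l) :
    TrilinearBound {p | l ≤ |evalAt (mixedDeriv a H) p| ∧ |evalAt H p| ≤ m}
      (ENNReal.ofReal ((k + 1) * √(2 * (n + 1)) * (m / l) ^ (1 / (2 * ((k : ℝ) + 1))))) := by
  induction k generalizing a l with
  | zero =>
    obtain ⟨i, b, hb, hab⟩ := exists_mixedDeriv_eq_pderiv ha
    have h := trilinearBound_pderiv hH i hl hm.le
    simpa [hab, mixedDeriv_of_order_eq_zero hb] using h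
  | succ k ih =>
    obtain ⟨i, b, hb, hab⟩ := exists_mixedDeriv_eq_pderiv ha
    set r : ℝ := m / l with hr
    have hr0 : 0 < r := div_pos hm hl
    -- The threshold `t` for which the two pieces obey the same bound.
    set t : ℝ := l * r ^ (1 / ((k : ℝ) + 2)) with ht
    have ht0 : 0 < t := by positivity
    have h₁ := trilinearBound_pderiv ((totalDegree_mixedDeriv_le H b).trans hH) i hl ht0.le
    have h₂ := ih hb ht0
    have e₁ : (t / l) ^ (1 / 2 : ℝ) = r ^ (1 / (2 * ((k : ℝ) + 2))) := by
      rw [ht, mul_div_cancel_left₀ _ hl.ne', ← Real.rpow_mul hr0.le]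
      congr 1
      field_simp
    have e₂ : (m / t) ^ (1 / (2 * ((k : ℝ) + 1))) = r ^ (1 / (2 * ((k : ℝ) + 2))) := by
      have : m / t = r ^ (1 - 1 / ((k : ℝ) + 2)) := by
        rw [Real.rpow_sub hr0, Real.rpow_one, ht, ← div_div]
      rw [this, ← Real.rpow_mul hr0.le]
      congr 1
      field_simp
      ring
    rw [e₁] at h₁
    rw [e₂] at h₂
    refine (h₁.union_of_subset h₂ ?_).mono (le_of_eq ?_)
    · rintro p ⟨hp, hpm⟩
      rw [hab] at hp
      rcases le_total |evalAt (mixedDeriv b H) p| t with h | h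
      · exact Or.inl ⟨hp, h⟩
      · exact Or.inr ⟨h, hpm⟩
    · rw [← ENNReal.ofReal_add (by positivity) (by positivity)]
      push_cast
      rw [add_assoc (k : ℝ) 1 1, one_add_one_eq_two]
      congr 1
      ring

/-! ### The sublevel form -/

lemma lintegral_rpow_enorm_eq_ofReal_l2Norm {f : ℝ → ℂ} (hf : MemLp f 2 volume) :
    (∫⁻ x, ‖f x‖ₑ ^ (2 : ℝ)) ^ (1 / 2 : ℝ) = ENNReal.ofReal (l2Norm f) := by
  rw [l2Norm, ENNReal.ofReal_toReal hf.eLpNorm_ne_top,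
    eLpNorm_eq_lintegral_rpow_enorm_toReal two_ne_zero ENNReal.ofNat_ne_top]
  simp

lemma aestronglyMeasurable_integrand (H : MvPolynomial (Fin 2) ℝ) (μ : ℝ) {f g h : ℝ → ℂ}
    (hf : AEStronglyMeasurable f) (hg : AEStronglyMeasurable g) (hh : AEStronglyMeasurable h) :
    AEStronglyMeasurable (integrand H μ f g h) := by
  have hS : MeasurableSet {q : ℝ × ℝ | |evalAt H q| ≤ μ} :=
    (isClosed_le (continuous_evalAt H).abs continuous_const).measurableSet
  exact ((((stronglyMeasurable_const.indicator hS).aestronglyMeasurable).mul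
    (hf.comp_quasiMeasurePreserving Measure.quasiMeasurePreserving_fst)).mul
    (hg.comp_quasiMeasurePreserving Measure.quasiMeasurePreserving_snd)).mul
    (hh.comp_quasiMeasurePreserving (quasiMeasurePreserving_add volume volume))

lemma measurableSet_domain {N : ℕ} (H : MvPolynomial (Fin 2) ℝ) (α : Fin N → ℕ × ℕ) :
    MeasurableSet (domain H α) := by
  have hclosed : MeasurableSet (⋂ i, {p | 1 ≤ |evalAt (mixedDeriv (α i) H) p|}) :=
    MeasurableSet.iInter fun i =>
      (isClosed_le continuous_const (continuous_evalAt _).abs).measurableSet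
  have hsquare : MeasurableSet (Set.Icc (0 : ℝ) 1 ×ˢ Set.Icc (0 : ℝ) 1) :=
    measurableSet_Icc.prod measurableSet_Icc
  convert hsquare.inter hclosed using 1
  ext p
  simp only [domain, Set.mem_ofPred_eq, Set.mem_inter_iff, Set.mem_iInter]

lemma lintegral_enorm_integrand_le {H : MvPolynomial (Fin 2) ℝ} {D : Set (ℝ × ℝ)}
    (hD : MeasurableSet D) {μ A : ℝ} (hA : 0 ≤ A) {f g h : ℝ → ℂ}
    (hf : MemLp f 2 volume) (hg : MemLp g 2 volume) (hh : MemLp h 2 volume)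
    (hbound : TrilinearBound (D ∩ {p | |evalAt H p| ≤ μ}) (ENNReal.ofReal A)) :
    ∫⁻ p in D, ‖integrand H μ f g h p‖ₑ ≤
      ENNReal.ofReal (A * l2Norm f * l2Norm g * l2Norm h) := by
  have hS : MeasurableSet {q : ℝ × ℝ | |evalAt H q| ≤ μ} :=
    (isClosed_le (continuous_evalAt H).abs continuous_const).measurableSet
  have heq : ∫⁻ p in D, ‖integrand H μ f g h p‖ₑ =
      ∫⁻ p in D ∩ {p | |evalAt H p| ≤ μ}, ‖f p.1‖ₑ * ‖g p.2‖ₑ * ‖h (p.1 + p.2)‖ₑ := by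
    rw [← lintegral_indicator hD, ← lintegral_indicator (hD.inter hS),
      ← Set.indicator_indicator]
    refine lintegral_congr fun p => congrFun (congrArg _ (funext fun q => ?_)) p
    by_cases hq : |evalAt H q| ≤ μ <;> simp [integrand, Set.indicator, hq]
  have hb := hbound (fun x => ‖f x‖ₑ) (fun x => ‖g x‖ₑ) (fun x => ‖h x‖ₑ)
    hf.1.enorm hg.1.enorm hh.1.enorm
  rw [lintegral_rpow_enorm_eq_ofReal_l2Norm hf, lintegral_rpow_enorm_eq_ofReal_l2Norm hg,
    lintegral_rpow_enorm_eq_ofReal_l2Norm hh] at hb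
  have h0 : ∀ u, 0 ≤ l2Norm u := fun u => ENNReal.toReal_nonneg
  rw [ENNReal.ofReal_mul (mul_nonneg (mul_nonneg hA (h0 f)) (h0 g)),
    ENNReal.ofReal_mul (mul_nonneg hA (h0 f)), ENNReal.ofReal_mul hA, heq]
  exact hb

end TrilinearSublevel

theorem mainTheorem3 (n : ℕ) :
    ∃ C : ℝ, 0 < C ∧
      ∀ (H : MvPolynomial (Fin 2) ℝ), H.totalDegree = n →
      ∀ (N : ℕ) (α : Fin N → ℕ × ℕ), (∀ i, α i ≠ (0, 0)) →
      ∀ (d : ℕ), IsLeast (Set.range fun i => TrilinearSublevel.order (α i)) d →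
      ∀ (μ : ℝ), 0 < μ →
      ∀ (f g h : ℝ → ℂ), MemLp f 2 volume → MemLp g 2 volume → MemLp h 2 volume →
        IntegrableOn (TrilinearSublevel.integrand H μ f g h)
            (TrilinearSublevel.domain H α) volume ∧
          ‖TrilinearSublevel.sublevelForm H (TrilinearSublevel.domain H α) μ f g h‖ ≤
            C * μ ^ (1 / (2 * (d : ℝ))) * TrilinearSublevel.l2Norm f *
              TrilinearSublevel.l2Norm g * TrilinearSublevel.l2Norm h := by
  open TrilinearSublevel in
  refine ⟨(n + 1) * √(2 * (n + 1)), by positivity, ?_⟩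
  intro H hH N α hα d hd μ hμ f g h hf hg hh
  obtain ⟨i, hi⟩ := hd.1
  have hi : order (α i) = d := hi
  obtain ⟨k, rfl⟩ : ∃ k, d = k + 1 := by
    refine Nat.exists_eq_succ_of_ne_zero fun h0 => hα i ?_
    simp only [order, h0, Nat.add_eq_zero_iff] at hi
    exact Prod.ext hi.1 hi.2
  set A : ℝ := (n + 1) * √(2 * (n + 1)) * μ ^ (1 / (2 * ((k + 1 : ℕ) : ℝ))) with hA
  have hA0 : 0 ≤ A := by positivity
  have hbound : TrilinearBound (domain H α ∩ {p | |evalAt H p| ≤ μ}) (ENNReal.ofReal A) := by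
    by_cases hzero : mixedDeriv (α i) H = 0
    · -- The constraint `|∂^{α i} H| ≥ 1` fails everywhere, so the domain is empty.
      have hempty : domain H α ∩ {p | |evalAt H p| ≤ μ} = ∅ := by
        refine Set.eq_empty_of_forall_notMem fun p hp => ?_
        have := hp.1.2 i
        rw [hzero] at this
        simp [evalAt] at this
        linarith
      intro f g h _ _ _
      simp [hempty]
    · -- A nonzero derivative has order at most `n`, which makes the constant independent of `d`.
      have hkn : k + 1 ≤ n := by
        have := order_add_totalDegree_mixedDeriv_le H (α i) hzero
        omega
      have hkn' : (k : ℝ) + 1 ≤ n + 1 := by exact_mod_cast hkn.trans n.le_succ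
      have hb := trilinearBound_mixedDeriv hH.le hμ k hi one_pos
      intro f g h hf hg hh
      refine (lintegral_mono_set ?_).trans ((hb.mono (ENNReal.ofReal_le_ofReal ?_)) f g h hf hg hh)
      · exact fun p hp => ⟨hp.1.2 i, hp.2⟩
      · rw [div_one, hA]
        push_cast
        gcongr
  have hlin := lintegral_enorm_integrand_le (measurableSet_domain H α) hA0 hf hg hh hbound
  have hmeas := (aestronglyMeasurable_integrand H μ hf.1 hg.1 hh.1).restrict
    (s := domain H α)
  refine ⟨⟨hmeas, hlin.trans_lt ENNReal.ofReal_lt_top⟩, ?_⟩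
  have h0 : ∀ u, 0 ≤ l2Norm u := fun u => ENNReal.toReal_nonneg
  rw [← ENNReal.ofReal_le_ofReal_iff
    (mul_nonneg (mul_nonneg (mul_nonneg hA0 (h0 f)) (h0 g)) (h0 h)), ofReal_norm]
  exact (enorm_integral_le_lintegral_enorm _).trans hlin
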